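/- Identify a concept class with a subset $C\subseteq\{0,1\}^n$, and write $\overline C=\{0,1\}^n\setminus C$. Let $\mathrm{VC}(C)$ be its VC dimension, and call $C$ *$e$-maximum* if $\mathrm{VC}(C)=e$ and $|C|=\sum_{i=0}^{e}\binom ni$. For $1\le i\le n$ let $\pi_{\le i}$ be the projection of the cube onto the coordinates $1,\dots,i$. For a class $M$ let $J_i(M)\subseteq\{0,1\}^{[n]\setminus\{i\}}$ be its projection along $i$ (forget coordinate $i$), and let its reduction $R_i(M)\subseteq J_i(M)$ be the set of points of $J_i(M)$ both of whose extensions to coordinate $i$ lie in $M$. The components of $J_i(M)$ split by $R_i(M)$ are the connected components of the subgraph of the cube graph induced on $J_i(M)\setminus R_i(M)$. For $K\subseteq\{0,1\}^{[n]\setminus\{i\}}$, $K\times\{j\}$ denotes the copy of $K$ at level $x_i=j$. Given $n,d,k$ and $\overline C$, the lifting-and-filtering algorithm is the following. Initially the queue $\mathcal M$ consists of the single class of all points with at most $n-d-k-1$ ones (the empty class if $d+k=n$); if $d+k>n$ the queue is empty. For $i=1,\dots,n$: put $P=\pi_{\le i}(\overline C)$ and replace $\mathcal M$ by the set of all classes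 obtained from its members $M$ in this way. Let $R=R_i(M)$ and $J=J_i(M)$. If $\pi_{\le i}(R\times\{0,1\})\not\subseteq P$, discard $M$. Otherwise, for each component $K$ of $J$ split by $R$ let $S_K$ be the set of those copies $K\times\{j\}$, $j\in\{0,1\}$, with $\pi_{\le i}(K\times\{j\})\subseteq P$; for every choice of one member of $S_K$ for each $K$, the union of $R\times\{0,1\}$ and the chosen copies is a new class (so $M$ is discarded if some $S_K$ is empty). After step $n$ the algorithm returns $\mathcal M$. **Proposition.** Let $C\subseteq\{0,1\}^n$ have VC dimension $d$ and let $k>0$. Run on $\overline C$, the algorithm returns exactly the complements of the $(d+k)$-maximum classes containing $C$; that is, for every $D\subseteq\{0,1\}^n$, $\overline D$ is in the output if and only if $D$ is $(d+k)$-maximum and $C\subseteq D$. -/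

import Mathlib

open Finset

/-! A concept in the binary `n`-cube `{0,1}^n` is identified with its support, an element of
`Finset (Fin n)`; a concept class is a `Finset (Finset (Fin n))`. The coordinates `1, …, n` of the
cube are the elements of `Fin n`, in their order. -/

namespace VCEmbed

/-- `C` is a maximum class of VC dimension `e` in the `n`-cube: its VC dimension is `e` and it meets
Sauer's bound with equality. -/
def IsMaximum {n : ℕ} (C : Finset (Finset (Fin n))) (e : ℕ) : Prop :=
  C.vcDim = e ∧ C.card = ∑ i ∈ range (e + 1), n.choose i

/-- Projection of a class onto the coordinates up to and including `i` (the remaining coordinates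
are set to `0`). -/
def prefixProj {n : ℕ} (i : Fin n) (C : Finset (Finset (Fin n))) : Finset (Finset (Fin n)) :=
  C.image fun x => x ∩ Iic i

/-- Projection of a class along coordinate `i`. The `(n-1)`-cube on the other coordinates is
identified with the face `x i = 0` of the `n`-cube. -/
def projAlong {n : ℕ} (i : Fin n) (M : Finset (Finset (Fin n))) : Finset (Finset (Fin n)) :=
  M.image fun x => x.erase i

/-- Reduction of a class along coordinate `i`: the points of the projection along `i` both of whose
preimages belong to the class. -/
def reduction {n : ℕ} (i : Fin n) (M : Finset (Finset (Fin n))) : Finset (Finset (Fin n)) :=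
  (projAlong i M).filter fun x => x ∈ M ∧ insert i x ∈ M

/-- For `K` in the face `x i = 0`, the copy `K × {j}` of `K` at level `j` of coordinate `i`. -/
def level {n : ℕ} (i : Fin n) (K : Finset (Finset (Fin n))) (j : Bool) :
    Finset (Finset (Fin n)) :=
  if j then K.image (insert i) else K

/-- The subgraph of the `n`-cube graph spanned by `T`: two points of `T` are adjacent when they
differ in exactly one coordinate. -/
def cubeGraphOn {n : ℕ} (T : Finset (Finset (Fin n))) : SimpleGraph (Finset (Fin n)) where
  Adj x y := x ∈ T ∧ y ∈ T ∧ (symmDiff x y).card = 1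
  symm := ⟨fun x y h => ⟨h.2.1, h.1, by rw [symmDiff_comm]; exact h.2.2⟩⟩
  loopless := ⟨fun x h => by simp at h⟩

open Classical in
/-- The connected components of `J` split by `R`: the (vertex sets of the) connected components of
the part of `J` outside `R`. -/
noncomputable def splitComponents {n : ℕ} (J R : Finset (Finset (Fin n))) :
    Finset (Finset (Finset (Fin n))) :=
  (J \ R).image fun x => (J \ R).filter fun y => (cubeGraphOn (J \ R)).Reachable x y

/-- The admissible positions of a component `K`: those copies `K × {0}`, `K × {1}` whose projection
onto the coordinates processed so far is contained in `P`. -/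
def positions {n : ℕ} (P : Finset (Finset (Fin n))) (i : Fin n) (K : Finset (Finset (Fin n))) :
    Finset (Finset (Finset (Fin n))) :=
  ((univ : Finset Bool).image (level i K)).filter fun L => prefixProj i L ⊆ P

/-- Processing of one class `M` popped from the queue, at coordinate `i`. The lifts of `M` contain
`R × {0,1}`, where `R` is the reduction of `M` along `i`; `M` is discarded if the projection of
`R × {0,1}` is not contained in `P`. Otherwise every way of choosing an admissible position for each
component of the projection `J` of `M` split by `R` gives one new class. (If some component has no
admissible position, the product of the sets of positions is empty and `M` is discarded.) -/
noncomputable def processClass {n : ℕ} (P : Finset (Finset (Fin n))) (i : Fin n)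
    (M : Finset (Finset (Fin n))) : Finset (Finset (Finset (Fin n))) :=
  let R := reduction i M
  let J := projAlong i M
  let RR := level i R false ∪ level i R true
  let K := splitComponents J R
  if prefixProj i RR ⊆ P then
    (K.pi (positions P i)).image fun f => RR ∪ K.attach.biUnion fun k => f k.1 k.2
  else ∅

/-- The initial queue: the closed-below `(n-d-k-1)`-complete collection, i.e. the class of all points
with at most `n - d - k - 1` ones (the empty class when `n = d + k`). When `n < d + k` there is no
such collection and the queue is empty. -/
def initialQueue (n d k : ℕ) : Finset (Finset (Finset (Fin n))) :=
  if d + k ≤ n then {univ.filter fun x => x.card + d + k + 1 ≤ n} else ∅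

/-- The lifting-and-filtering algorithm, run on the complement `Cbar` of a class: for `i = 1, …, n`,
the queue is replaced by all classes obtained by processing its members at coordinate `i`. -/
noncomputable def allEmbeddings (n d k : ℕ) (Cbar : Finset (Finset (Fin n))) :
    Finset (Finset (Finset (Fin n))) :=
  (List.finRange n).foldl
    (fun queue i => queue.biUnion (processClass (prefixProj i Cbar) i)) (initialQueue n d k)

end VCEmbed

/-! Let `F` be the initial class, a lower set. Call a class ample when it shatters exactly as many
sets as it has members. The complement of an ample class shatters `A` iff the class does not shatter
`Aᶜ`, so for `d + k ≤ n` the complements of `(d+k)`-maximum classes are the classes of size `|F|`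
that shatter only members of `F` (`isMaximum_iff_compl`). Down-compressing such a class along every
coordinate ends in `F`; the algorithm undoes these compressions one at a time. A lift keeps the size
and shatters nothing outside `F` (`IsStage.lift`). Conversely, every ample class is a lift of its
compression (`IsAmple.exists_isLift_compression`). Both rest on isometry of ample classes
(`IsAmple.exists_step`). Filtering loses nothing: compressing a later coordinate never enlarges an
earlier prefix projection, so the last test, inclusion in `Cᶜ`, implies the earlier ones along the
chain of compressions. -/

namespace VCEmbed

open scoped FinsetFamily

/-! ### Ample families: faces, isometry, cubes and complements. -/

section Ample

variable {α : Type*} [DecidableEq α]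

/-- A set family is ample (shattering-extremal) when it meets Pajor's bound with equality. -/
def IsAmple (M : Finset (Finset α)) : Prop := M.shatterer.card ≤ M.card

theorem shatters_of_mem_of_erase_mem {M : Finset (Finset α)} {A : Finset α} {a : α}
    (h : ∀ t ⊆ A, ∃ u, A ∩ u = t ∧ insert a u ∈ M ∧ u.erase a ∈ M) :
    M.Shatters (insert a A) := by
  intro t ht
  obtain ⟨u, hu, h1, h0⟩ := h (t ∩ A) inter_subset_right
  have hu' : ∀ x ∈ A, x ∈ u ↔ x ∈ t := fun x hx => by
    have := congrArg (x ∈ ·) hu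
    simpa [hx] using this
  by_cases ha : a ∈ t
  · refine ⟨_, h1, ?_⟩
    ext x
    have := @ht x
    have := hu' x
    simp only [mem_inter, mem_insert] at *
    grind
  · refine ⟨_, h0, ?_⟩
    ext x
    have := @ht x
    have := hu' x
    simp only [mem_inter, mem_insert, mem_erase] at *
    grind

/-- A set shattered by either half avoids `a` and is shattered by `M`; if both halves shatter `A`,
then `M` also shatters `insert a A`. Count union and intersection. -/
theorem card_shatterer_filter_add_le (M : Finset (Finset α)) (a : α) :
    (M.filter (a ∈ ·)).shatterer.card + (M.filter (a ∉ ·)).shatterer.card ≤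
      M.shatterer.card := by
  set S₁ := (M.filter (a ∈ ·)).shatterer with hS₁
  set S₀ := (M.filter (a ∉ ·)).shatterer with hS₀
  have h0 : ∀ A ∈ S₀, a ∉ A := fun A hA ha => by
    obtain ⟨u, hu, hAu⟩ := (mem_shatterer.1 hA).exists_superset
    exact (mem_filter.1 hu).2 (hAu ha)
  have h1 : ∀ A ∈ S₁, a ∉ A := fun A hA ha => by
    obtain ⟨u, hu, hAu⟩ := (mem_shatterer.1 hA) (empty_subset A)
    exact notMem_empty a (hAu ▸ mem_inter.2 ⟨ha, (mem_filter.1 hu).2⟩)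
  have hU : S₁ ∪ S₀ ⊆ M.shatterer.nonMemberSubfamily a := by
    intro A hA
    rw [mem_nonMemberSubfamily]
    rcases mem_union.1 hA with hA | hA
    · exact ⟨shatterer_mono (filter_subset _ _) hA, h1 A hA⟩
    · exact ⟨shatterer_mono (filter_subset _ _) hA, h0 A hA⟩
  have hI : S₁ ∩ S₀ ⊆ M.shatterer.memberSubfamily a := by
    intro A hA
    rw [mem_inter] at hA
    have haA := h0 A hA.2
    rw [mem_memberSubfamily, mem_shatterer]
    refine ⟨fun t ht => ?_, haA⟩
    by_cases hat : a ∈ t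
    · obtain ⟨u, hu, hut⟩ := (mem_shatterer.1 hA.1) (inter_subset_right (s₁ := t))
      rw [mem_filter] at hu
      refine ⟨u, hu.1, ?_⟩
      rw [insert_inter_of_mem hu.2, hut]
      ext x
      have := @ht x
      simp only [mem_insert, mem_inter] at *
      grind
    · obtain ⟨u, hu, hut⟩ := (mem_shatterer.1 hA.2) ((subset_insert_iff_of_notMem hat).1 ht)
      rw [mem_filter] at hu
      exact ⟨u, hu.1, by rw [insert_inter_of_notMem hu.2, hut]⟩
  have := card_le_card hU
  have := card_le_card hI
  have := card_union_add_card_inter S₁ S₀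
  have := card_memberSubfamily_add_card_nonMemberSubfamily a M.shatterer
  omega

/-- Pajor's bound on each half and the superadditivity above leave no slack. -/
theorem IsAmple.filter_mem {M : Finset (Finset α)} (hM : IsAmple M) (a : α) :
    IsAmple (M.filter (a ∈ ·)) ∧ IsAmple (M.filter (a ∉ ·)) := by
  have h := card_shatterer_filter_add_le M a
  have h1 := card_le_card_shatterer (M.filter (a ∈ ·))
  have h0 := card_le_card_shatterer (M.filter (a ∉ ·))
  have hc := card_filter_add_card_filter_not (s := M) (a ∈ ·)
  unfold IsAmple at *
  constructor <;> omega

theorem IsAmple.face {M : Finset (Finset α)} (hM : IsAmple M) (S x : Finset α) :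
    IsAmple (M.filter fun z => ∀ i ∈ S, i ∈ z ↔ i ∈ x) := by
  induction S using Finset.induction_on with
  | empty => simpa using hM
  | insert a S _ ih =>
    by_cases ha : a ∈ x
    · convert (ih.filter_mem a).1 using 1
      ext z; simp [ha]; tauto
    · convert (ih.filter_mem a).2 using 1
      ext z; simp [ha]; tauto

/-- Ample families are isometric: between two members one can move one step closer. -/
theorem IsAmple.exists_step [Fintype α] {M : Finset (Finset α)} (hM : IsAmple M) :
    ∀ {x y : Finset α}, x ∈ M → y ∈ M → x ≠ y → ∃ j ∈ symmDiff x y, symmDiff x {j} ∈ M := by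
  suffices H : ∀ m, ∀ x ∈ M, ∀ y ∈ M, x ≠ y → (symmDiff x y).card = m →
      ∃ j ∈ symmDiff x y, symmDiff x {j} ∈ M from
    fun {x y} hx hy hxy => H _ x hx y hy hxy rfl
  intro m
  induction m using Nat.strong_induction_on with
  | _ m ih =>
  intro x hx y hy hxy hm
  by_contra! hno
  obtain ⟨T, hT⟩ : ∃ T, T = symmDiff x y := ⟨_, rfl⟩
  rw [← hT] at hno hm
  -- `G` is the part of `M` in the smallest face containing `x` and `y`. By induction a third point
  -- of `G` would give a step from `x` inside `T`, so `G` has at most two members; yet it shatters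
  -- three sets.
  set G := M.filter fun z => ∀ i ∈ Tᶜ, i ∈ z ↔ i ∈ x with hG
  have hGA : IsAmple G := by
    convert hM.face Tᶜ x
  have hG2 : G ⊆ {x, y} := by
    intro z hz
    rw [hG, mem_filter] at hz
    by_contra hne
    simp only [mem_insert, mem_singleton, not_or] at hne
    have hsub : symmDiff x z ⊆ T := by
      intro i hi
      by_contra hiT
      have := hz.2 i (mem_compl.2 hiT)
      rw [mem_symmDiff] at hi
      tauto
    have hss : symmDiff x z ≠ T := fun h => hne.2 (symmDiff_right_injective x (h.trans hT))
    obtain ⟨j, hj, hjM⟩ := ih _ (hm ▸ card_lt_card (hsub.ssubset_of_ne hss)) x hx z hz.1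
      (Ne.symm hne.1) rfl
    exact hno j (hsub hj) hjM
  have hxG : x ∈ G := by simp [hG, hx]
  have hyG : y ∈ G := by
    simp only [hG, mem_filter, hy, true_and, hT, mem_compl, mem_symmDiff]
    intro i; tauto
  have hsing : ∀ j ∈ T, G.Shatters {j} := by
    intro j hj t ht
    rw [subset_singleton_iff] at ht
    rw [hT, mem_symmDiff] at hj
    rcases ht with rfl | rfl <;> rcases hj with hj | hj
    · exact ⟨y, hyG, by simp [hj.2]⟩
    · exact ⟨x, hxG, by simp [hj.2]⟩
    · exact ⟨x, hxG, by simp [hj.1]⟩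
    · exact ⟨y, hyG, by simp [hj.1]⟩
  have hTne : T.Nonempty := by
    rw [nonempty_iff_ne_empty]
    intro h
    exact hxy (symmDiff_eq_bot.1 (hT.symm.trans h))
  obtain ⟨a, ha⟩ := hTne
  have hex : ∃ b ∈ T, b ≠ a := by
    by_contra! h
    have hTa : T = {a} := by
      ext i; rw [mem_singleton]; exact ⟨h i, fun h => h ▸ ha⟩
    apply hno a ha
    rw [← hTa, hT, symmDiff_symmDiff_cancel_left]
    exact hy
  obtain ⟨b, hb, hba⟩ := hex
  have h3 : ({∅, {a}, {b}} : Finset (Finset α)) ⊆ G.shatterer := by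
    intro A hA
    simp only [mem_insert, mem_singleton] at hA
    rw [mem_shatterer]
    rcases hA with rfl | rfl | rfl
    · exact shatters_empty.2 ⟨x, hxG⟩
    · exact hsing _ ha
    · exact hsing _ hb
  have hc3 : ({∅, {a}, {b}} : Finset (Finset α)).card = 3 := by
    rw [card_eq_three]
    exact ⟨∅, {a}, {b}, (singleton_ne_empty a).symm, (singleton_ne_empty b).symm,
      fun h => hba (singleton_injective h).symm, rfl⟩
  have := card_le_card h3
  have := card_le_card hG2
  have : ({x, y} : Finset (Finset α)).card ≤ 2 := card_le_two
  unfold IsAmple at hGA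
  omega

/-- The members of an ample family both of whose extensions along `a` belong to it form an ample
family, and a set `insert a B` is shattered only if `B` is shattered by that family. -/
theorem IsAmple.inter_subfamily {M : Finset (Finset α)} (hM : IsAmple M) (a : α) :
    IsAmple (M.memberSubfamily a ∩ M.nonMemberSubfamily a) ∧
      M.shatterer.memberSubfamily a =
        (M.memberSubfamily a ∩ M.nonMemberSubfamily a).shatterer := by
  set R := M.memberSubfamily a ∩ M.nonMemberSubfamily a with hR
  set J := M.memberSubfamily a ∪ M.nonMemberSubfamily a with hJ
  have hRsub : R.shatterer ⊆ M.shatterer.memberSubfamily a := by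
    intro A hA
    rw [mem_shatterer] at hA
    have haA : a ∉ A := fun ha => by
      obtain ⟨u, hu, hAu⟩ := hA.exists_superset
      rw [hR, mem_inter, mem_memberSubfamily] at hu
      exact hu.1.2 (hAu ha)
    rw [mem_memberSubfamily, mem_shatterer]
    refine ⟨shatters_of_mem_of_erase_mem fun t ht => ?_, haA⟩
    obtain ⟨u, hu, hut⟩ := hA ht
    rw [hR, mem_inter, mem_memberSubfamily, mem_nonMemberSubfamily] at hu
    exact ⟨u, hut, hu.1.1, by rw [erase_eq_of_notMem hu.1.2]; exact hu.2.1⟩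
  have hJsub : J.shatterer ⊆ M.shatterer.nonMemberSubfamily a := by
    intro A hA
    rw [mem_shatterer] at hA
    have haA : a ∉ A := fun ha => by
      obtain ⟨u, hu, hAu⟩ := hA.exists_superset
      rw [hJ, mem_union, mem_memberSubfamily, mem_nonMemberSubfamily] at hu
      rcases hu with hu | hu <;> exact hu.2 (hAu ha)
    rw [mem_nonMemberSubfamily, mem_shatterer]
    refine ⟨fun t ht => ?_, haA⟩
    obtain ⟨u, hu, hut⟩ := hA ht
    rw [hJ, mem_union, mem_memberSubfamily, mem_nonMemberSubfamily] at hu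
    rcases hu with hu | hu
    · exact ⟨_, hu.1, by rw [inter_insert_of_notMem haA, hut]⟩
    · exact ⟨u, hu.1, hut⟩
  -- Since `|R| + |J| = |M|`, Pajor's bound for `R` and `J` squeezes both inclusions of shatterers
  -- into equalities.
  have c1 := card_le_card hRsub
  have c2 := card_le_card hJsub
  have c3 := card_memberSubfamily_add_card_nonMemberSubfamily a M.shatterer
  have c4 := card_memberSubfamily_add_card_nonMemberSubfamily a M
  have c5 := card_union_add_card_inter (M.memberSubfamily a) (M.nonMemberSubfamily a)
  have c6 := card_le_card_shatterer R
  have c7 := card_le_card_shatterer J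
  unfold IsAmple at *
  rw [← hR, ← hJ] at c5
  exact ⟨by omega, (eq_of_subset_of_card_le hRsub (by omega)).symm⟩

/-- A set shattered by an ample family is the set of directions of a subcube in the family. -/
theorem IsAmple.exists_cube {A : Finset α} :
    ∀ {M : Finset (Finset α)}, IsAmple M → M.Shatters A →
      ∃ p : Finset α, Disjoint p A ∧ ∀ z, z \ A = p → z ∈ M := by
  induction A using Finset.induction_on with
  | empty =>
    intro M _ h
    obtain ⟨p, hp⟩ := shatters_empty.1 h
    exact ⟨p, by simp, by simp [hp]⟩
  | insert a A ha ih =>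
    intro M hM h
    obtain ⟨hR, hsh⟩ := hM.inter_subfamily a
    have hA : A ∈ M.shatterer.memberSubfamily a :=
      mem_memberSubfamily.2 ⟨mem_shatterer.2 h, ha⟩
    rw [hsh, mem_shatterer] at hA
    obtain ⟨p, hpA, hp⟩ := ih hR hA
    simp only [mem_inter, mem_memberSubfamily, mem_nonMemberSubfamily] at hp
    have hap : a ∉ p := (hp p (sdiff_eq_self_of_disjoint hpA)).1.2
    refine ⟨p, by simp [hpA, hap], fun z hz => ?_⟩
    have hz' : (z.erase a) \ A = p := by
      rw [← hz]; ext x; simp; tauto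
    by_cases haz : a ∈ z
    · simpa [insert_erase haz] using (hp _ hz').1.1
    · simpa [erase_eq_of_notMem haz] using (hp _ hz').2.1

/-- If `D` misses a pattern `p` on `Aᶜ`, the whole fibre over `p` lies in `Dᶜ`, and it carries every
pattern on `A`. -/
theorem shatters_compl_of_not_shatters [Fintype α] {D : Finset (Finset α)} {A : Finset α}
    (h : ¬ D.Shatters Aᶜ) : Dᶜ.Shatters A := by
  unfold Shatters at h
  push Not at h
  obtain ⟨p, hp, hno⟩ := h
  intro t ht
  refine ⟨t ∪ p, mem_compl.2 fun hD => hno _ hD ?_, ?_⟩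
  all_goals
    ext x
    have := @hp x
    have := @ht x
    simp only [mem_inter, mem_union, mem_compl] at *
    tauto

/-- A cube of `D` with directions `Aᶜ` is the whole fibre over one pattern on `A`, which `Dᶜ`
therefore misses. -/
theorem IsAmple.shatters_compl_iff [Fintype α] {D : Finset (Finset α)} (hD : IsAmple D)
    {A : Finset α} : Dᶜ.Shatters A ↔ ¬ D.Shatters Aᶜ := by
  refine ⟨fun hA h => ?_, shatters_compl_of_not_shatters⟩
  obtain ⟨p, hpA, hp⟩ := hD.exists_cube h
  have hpA' : p ⊆ A := fun x hx => by
    by_contra hxA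
    exact disjoint_left.1 hpA hx (mem_compl.2 hxA)
  obtain ⟨u, hu, hup⟩ := hA hpA'
  refine mem_compl.1 hu (hp u ?_)
  rw [← hup]; ext x; simp; tauto

end Ample

/-! ### Lifts and down-compressions as inverse operations. -/

section Lift

variable {n : ℕ}

/-- Isometry gives a geodesic inside `M`. The hypothesis puts all of `M` between `u` and `v` into
`T`, hence the geodesic too. -/
theorem IsAmple.reachable {M T : Finset (Finset (Fin n))} (hM : IsAmple M) {v : Finset (Fin n)}
    (hv : v ∈ M) :
    ∀ {u : Finset (Fin n)}, u ∈ M → (∀ w ∈ M, symmDiff u w ⊆ symmDiff u v → w ∈ T) →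
      (cubeGraphOn T).Reachable u v := by
  suffices H : ∀ m, ∀ u ∈ M, (∀ w ∈ M, symmDiff u w ⊆ symmDiff u v → w ∈ T) →
      (symmDiff u v).card = m → (cubeGraphOn T).Reachable u v from
    fun {u} hu h => H _ u hu h rfl
  intro m
  induction m with
  | zero =>
    intro u _ _ h
    rw [card_eq_zero] at h
    rw [symmDiff_eq_bot.1 h]
  | succ m ih =>
    intro u hu h hm
    have hne : u ≠ v := by
      rintro rfl
      simp at hm
    obtain ⟨j, hj, hjM⟩ := hM.exists_step hu hv hne
    have hstep : symmDiff (symmDiff u {j}) v = (symmDiff u v).erase j := by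
      ext x
      simp only [mem_symmDiff, mem_erase, mem_singleton] at *
      by_cases hx : x = j
      · subst hx; tauto
      · tauto
    have hT : ∀ w ∈ M, symmDiff (symmDiff u {j}) w ⊆ symmDiff (symmDiff u {j}) v → w ∈ T := by
      intro w hw hsub
      refine h w hw fun x hx => ?_
      rw [hstep] at hsub
      by_cases hxj : x = j
      · exact hxj ▸ hj
      · refine mem_of_mem_erase (hsub ?_)
        simp only [mem_symmDiff, mem_singleton] at *
        tauto
    refine SimpleGraph.Reachable.trans (SimpleGraph.Adj.reachable ⟨?_, ?_, ?_⟩)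
      (ih _ hjM hT ?_)
    · exact h u hu (by simp)
    · exact h _ hjM (by simpa using hj)
    · simp
    · rw [hstep, card_erase_of_mem hj, hm]; rfl

open Classical in
/-- The connected component of `x` in the subgraph of the cube spanned by `T`. -/
noncomputable def component (T : Finset (Finset (Fin n))) (x : Finset (Fin n)) :
    Finset (Finset (Fin n)) :=
  T.filter fun y => (cubeGraphOn T).Reachable x y

theorem mem_component {T : Finset (Finset (Fin n))} {x y : Finset (Fin n)} :
    y ∈ component T x ↔ y ∈ T ∧ (cubeGraphOn T).Reachable x y := by
  simp [component]

theorem component_congr {T : Finset (Finset (Fin n))} {x y : Finset (Fin n)}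
    (h : (cubeGraphOn T).Reachable x y) : component T x = component T y := by
  ext z
  simp only [mem_component]
  exact and_congr_right fun _ => ⟨h.symm.trans, h.trans⟩

theorem mem_splitComponents {J R K : Finset (Finset (Fin n))} :
    K ∈ splitComponents J R ↔ ∃ x ∈ J \ R, component (J \ R) x = K := by
  simp [splitComponents, component]

theorem mem_projAlong {i : Fin n} {M : Finset (Finset (Fin n))} {x : Finset (Fin n)} :
    x ∈ projAlong i M ↔ i ∉ x ∧ (x ∈ M ∨ insert i x ∈ M) := by
  rw [projAlong, ← memberSubfamily_union_nonMemberSubfamily, mem_union, mem_memberSubfamily,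
    mem_nonMemberSubfamily]
  tauto

theorem mem_reduction {i : Fin n} {M : Finset (Finset (Fin n))} {x : Finset (Fin n)} :
    x ∈ reduction i M ↔ i ∉ x ∧ x ∈ M ∧ insert i x ∈ M := by
  rw [reduction, mem_filter, mem_projAlong]
  tauto

theorem mem_level {i : Fin n} {K : Finset (Finset (Fin n))} (hK : ∀ x ∈ K, i ∉ x) {j : Bool}
    {z : Finset (Fin n)} : z ∈ level i K j ↔ z.erase i ∈ K ∧ (i ∈ z ↔ j = true) := by
  cases j
  · simp only [level, Bool.false_eq_true, if_false, iff_false]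
    refine ⟨fun h => ⟨by rwa [erase_eq_of_notMem (hK z h)], hK z h⟩, fun h => ?_⟩
    rw [← erase_eq_of_notMem h.2]; exact h.1
  · simp only [level, if_true, iff_true, mem_image]
    constructor
    · rintro ⟨x, hx, rfl⟩
      exact ⟨by rwa [erase_insert (hK x hx)], mem_insert_self _ _⟩
    · exact fun h => ⟨_, h.1, insert_erase h.2⟩

/-- `M'` arises from its projection and reduction along `i`, those of `M`, by placing each component
`K` of the projection split by the reduction at the level `g K`. -/
def IsLift (i : Fin n) (M M' : Finset (Finset (Fin n)))
    (g : Finset (Finset (Fin n)) → Bool) : Prop :=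
  ∀ z, z ∈ M' ↔ z.erase i ∈ reduction i M ∨
    (z.erase i ∈ projAlong i M \ reduction i M ∧
      (i ∈ z ↔ g (component (projAlong i M \ reduction i M) (z.erase i)) = true))

theorem mem_level_component {i : Fin n} {M : Finset (Finset (Fin n))} {x z : Finset (Fin n)}
    {j : Bool} :
    z ∈ level i (component (projAlong i M \ reduction i M) x) j ↔
      (z.erase i ∈ projAlong i M \ reduction i M ∧
        component (projAlong i M \ reduction i M) (z.erase i) =
          component (projAlong i M \ reduction i M) x) ∧ (i ∈ z ↔ j = true) := by
  rw [mem_level, mem_component]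
  · refine and_congr_left fun _ => and_congr_right fun h => ⟨fun h => (component_congr h).symm,
      fun h' => ?_⟩
    have : z.erase i ∈ component (projAlong i M \ reduction i M) x := by
      rw [← h', mem_component]
      exact ⟨h, SimpleGraph.Reachable.refl _⟩
    exact (mem_component.1 this).2
  · intro y hy
    exact (mem_projAlong.1 (mem_sdiff.1 (mem_component.1 hy).1).1).1

theorem mem_level_reduction {i : Fin n} {M : Finset (Finset (Fin n))} {z : Finset (Fin n)} :
    z ∈ level i (reduction i M) false ∪ level i (reduction i M) true ↔
      z.erase i ∈ reduction i M := by
  have h : ∀ x ∈ reduction i M, i ∉ x := fun x hx => (mem_reduction.1 hx).1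
  rw [mem_union, mem_level h, mem_level h]
  by_cases hz : i ∈ z <;> simp [hz]

/-- Projection commutes with unions, so the separate tests on `R × {0,1}` and on each copy amount to
one test on the lift. The dependent choice of copies becomes a total level function `g`. -/
theorem mem_processClass {P : Finset (Finset (Fin n))} {i : Fin n}
    {M M' : Finset (Finset (Fin n))} :
    M' ∈ processClass P i M ↔ prefixProj i M' ⊆ P ∧ ∃ g, IsLift i M M' g := by
  have hmono : ∀ {A B : Finset (Finset (Fin n))}, A ⊆ B → prefixProj i B ⊆ P →
      prefixProj i A ⊆ P := fun hAB hB => (image_subset_image hAB).trans hB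
  simp only [processClass]
  constructor
  · split_ifs with hR
    swap
    · simp
    intro h
    obtain ⟨f, hf, rfl⟩ := mem_image.1 h
    rw [mem_pi] at hf
    have hlev : ∀ K, ∃ j, ∀ hK : K ∈ splitComponents (projAlong i M) (reduction i M),
        f K hK = level i K j := by
      intro K
      by_cases hK : K ∈ splitComponents (projAlong i M) (reduction i M)
      · obtain ⟨j, -, hj⟩ := mem_image.1 (mem_filter.1 (hf K hK)).1
        exact ⟨j, fun _ => hj.symm⟩
      -- Arbitrary value off the components.
      · exact ⟨true, fun h => absurd h hK⟩
    choose g hg using hlev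
    refine ⟨?_, g, fun z => ?_⟩
    · rw [prefixProj, image_union, union_subset_iff]
      refine ⟨hR, ?_⟩
      intro y hy
      obtain ⟨z, hz, rfl⟩ := mem_image.1 hy
      obtain ⟨k, -, hk⟩ := mem_biUnion.1 hz
      exact (mem_filter.1 (hf k.1 k.2)).2 (mem_image_of_mem _ hk)
    · rw [mem_union, mem_level_reduction]
      refine or_congr_right ?_
      rw [mem_biUnion]
      constructor
      · rintro ⟨⟨K, hK⟩, -, hz⟩
        simp only [hg K hK] at hz
        obtain ⟨x, -, rfl⟩ := mem_splitComponents.1 hK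
        obtain ⟨⟨h1, h2⟩, h3⟩ := mem_level_component.1 hz
        exact ⟨h1, h2 ▸ h3⟩
      · rintro ⟨h1, h2⟩
        refine ⟨⟨_, mem_splitComponents.2 ⟨_, h1, rfl⟩⟩, mem_attach _ _, ?_⟩
        simp only [hg]
        exact mem_level_component.2 ⟨⟨h1, rfl⟩, h2⟩
  · rintro ⟨hP, g, hg⟩
    have hRM : level i (reduction i M) false ∪ level i (reduction i M) true ⊆ M' :=
      fun z hz => (hg z).2 (Or.inl (mem_level_reduction.1 hz))
    have hKM : ∀ K ∈ splitComponents (projAlong i M) (reduction i M), level i K (g K) ⊆ M' := by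
      intro K hK z hz
      obtain ⟨x, -, rfl⟩ := mem_splitComponents.1 hK
      obtain ⟨⟨h1, h2⟩, h3⟩ := mem_level_component.1 hz
      exact (hg z).2 (Or.inr ⟨h1, h2 ▸ h3⟩)
    rw [if_pos (hmono hRM hP), mem_image]
    refine ⟨fun K _ => level i K (g K), mem_pi.2 fun K hK => mem_filter.2
      ⟨mem_image_of_mem _ (mem_univ _), hmono (hKM K hK) hP⟩, ?_⟩
    refine Subset.antisymm (union_subset hRM (biUnion_subset.2 fun k _ => hKM k.1 k.2)) ?_
    intro z hz
    rw [mem_union, mem_level_reduction]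
    refine ((hg z).1 hz).imp_right fun h => mem_biUnion.2
      ⟨⟨_, mem_splitComponents.2 ⟨_, h.1, rfl⟩⟩, mem_attach _ _, ?_⟩
    exact mem_level_component.2 ⟨⟨h.1, rfl⟩, h.2⟩

/-- The classes in the queue once the coordinates below `m` have been processed, before filtering:
they have the size of `F`, shatter only members of `F`, and are closed below in the remaining
coordinates. -/
structure IsStage (F : Finset (Finset (Fin n))) (m : ℕ) (M : Finset (Finset (Fin n))) : Prop where
  shatterer_subset : M.shatterer ⊆ F
  card_eq : M.card = F.card
  erase_mem : ∀ j : Fin n, m ≤ j → ∀ x ∈ M, x.erase j ∈ M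

theorem IsStage.isAmple {F M : Finset (Finset (Fin n))} {m : ℕ} (h : IsStage F m M) :
    IsAmple M :=
  (card_le_card h.shatterer_subset).trans h.card_eq.ge

/-- Compression moves every singly placed copy to level `0`, where closure under erasing `i` already
puts it in `M`. -/
theorem compression_eq_of_isLift {i : Fin n} {M M' : Finset (Finset (Fin n))}
    {g : Finset (Finset (Fin n)) → Bool} (hM : ∀ x ∈ M, x.erase i ∈ M) (hg : IsLift i M M' g) :
    𝓓 i M' = M := by
  ext z
  rw [Down.mem_compression, hg z, hg (z.erase i), hg (insert i z)]
  simp only [mem_sdiff, mem_projAlong, mem_reduction]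
  by_cases hz : i ∈ z
  · have h := hM z
    simp [hz, insert_erase hz]
    generalize g (component (projAlong i M \ reduction i M) (z.erase i)) = b
    cases b <;> simp <;> tauto
  · have h := hM (insert i z)
    simp [hz] at h ⊢
    generalize g (component (projAlong i M \ reduction i M) z) = b
    cases b <;> simp <;> tauto

/-- The size is preserved because compressing the lift returns `M`. The substance is that a lift
shatters no set that `M` does not shatter. -/
theorem IsStage.lift {F M M' : Finset (Finset (Fin n))} {i : Fin n}
    {g : Finset (Finset (Fin n)) → Bool} (hM : IsStage F i M) (hg : IsLift i M M' g) :
    IsStage F (i + 1) M' := by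
  have hcl : ∀ x ∈ M, x.erase i ∈ M := hM.erase_mem i le_rfl
  have hcomp := compression_eq_of_isLift hcl hg
  set R := reduction i M with hR
  set J := projAlong i M with hJ
  have memR : ∀ x, x ∈ R ↔ i ∉ x ∧ insert i x ∈ M := fun x => by
    rw [hR, mem_reduction]
    refine and_congr_right fun hx => and_iff_right_of_imp fun h => ?_
    simpa [hx] using hcl _ h
  have memJ : ∀ x, x ∈ J ↔ i ∉ x ∧ x ∈ M := fun x => by
    rw [hJ, mem_projAlong]
    refine and_congr_right fun hx => or_iff_left_of_imp fun h => ?_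
    simpa [hx] using hcl _ h
  refine ⟨fun A hA => ?_, by rw [← Down.card_compression i M', hcomp, hM.card_eq], ?_⟩
  · rw [mem_shatterer] at hA
    apply hM.shatterer_subset
    rw [mem_shatterer]
    by_cases hiA : i ∈ A
    swap
    · intro t ht
      obtain ⟨u, hu, rfl⟩ := hA ht
      refine ⟨u.erase i, ?_, ?_⟩
      · rw [hg u] at hu
        rcases hu with hu | hu
        · exact (mem_reduction.1 hu).2.1
        · exact ((memJ _).1 (mem_sdiff.1 hu.1).1).2
      · rw [inter_erase, erase_eq_of_notMem fun h => hiA (mem_inter.1 h).1]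
    -- Some pattern `p` on `A.erase i` is missed by `R`. Members `u`, `v` of the lift realise `p`
    -- and `insert i p` on `A`. Everything of `M` between their projections also shows `p`, hence
    -- avoids `R`; so the projections share a component, yet `u` and `v` lie at different levels.
    by_contra hno
    have hRB : ¬ R.Shatters (A.erase i) := by
      intro h
      apply hno
      rw [← insert_erase hiA]
      refine shatters_of_mem_of_erase_mem fun t ht => ?_
      obtain ⟨u, hu, hut⟩ := h ht
      obtain ⟨h1, h2, h3⟩ := mem_reduction.1 hu
      exact ⟨u, hut, h3, by rwa [erase_eq_of_notMem h1]⟩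
    unfold Shatters at hRB
    push Not at hRB
    obtain ⟨p, hp, hpR⟩ := hRB
    have hpA : p ⊆ A := hp.trans (erase_subset _ _)
    have hip : i ∉ p := fun h => notMem_erase i A (hp h)
    obtain ⟨u, hu, hup⟩ := hA hpA
    obtain ⟨v, hv, hvp⟩ := hA (insert_subset hiA hpA)
    have hiu : i ∉ u := fun h => hip (hup ▸ mem_inter.2 ⟨hiA, h⟩)
    have hiv : i ∈ v := by
      have : i ∈ A ∩ v := hvp ▸ mem_insert_self i p
      exact (mem_inter.1 this).2
    have hu' : A.erase i ∩ u.erase i = p := by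
      rw [← hup]; ext x; simp only [mem_inter, mem_erase]; grind
    have hv' : A.erase i ∩ v.erase i = p := by
      have : p = (insert i p).erase i := by rw [erase_insert hip]
      rw [this, ← hvp]; ext x; simp only [mem_inter, mem_erase]; grind
    obtain ⟨huT, hgu⟩ := ((hg u).1 hu).resolve_left fun h => hpR _ h hu'
    obtain ⟨hvT, hgv⟩ := ((hg v).1 hv).resolve_left fun h => hpR _ h hv'
    have hreach : (cubeGraphOn (J \ R)).Reachable (u.erase i) (v.erase i) := by
      refine hM.isAmple.reachable ((memJ _).1 (mem_sdiff.1 hvT).1).2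
        ((memJ _).1 (mem_sdiff.1 huT).1).2 fun w hw hsub => ?_
      have hwx : ∀ x, (x ∈ u.erase i ↔ x ∈ v.erase i) → (x ∈ w ↔ x ∈ u.erase i) := by
        intro x hx
        have := @hsub x
        simp only [mem_symmDiff] at this
        tauto
      have hiw : i ∉ w := by
        rw [hwx i (by simp)]; simp
      rw [mem_sdiff]
      refine ⟨(memJ w).2 ⟨hiw, hw⟩, fun h => hpR w h ?_⟩
      ext x
      have h1 := hwx x
      have h2 := Finset.ext_iff.1 hu' x
      have h3 := Finset.ext_iff.1 hv' x
      rw [mem_inter] at h2 h3 ⊢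
      tauto
    rw [component_congr hreach] at hgu
    exact hiu (hgu.2 (hgv.1 hiv))
  · intro j hj z hz
    have hij : i ≠ j := by rintro rfl; omega
    have hj' : (i : ℕ) ≤ j := by omega
    rw [hg] at hz ⊢
    have hcomm : (z.erase j).erase i = (z.erase i).erase j := erase_right_comm
    have hmem : i ∈ z.erase j ↔ i ∈ z := by simp [hij]
    rw [hcomm, hmem]
    have hRcl : ∀ x ∈ R, x.erase j ∈ R := by
      intro x hx
      rw [memR] at hx ⊢
      refine ⟨fun h => hx.1 (mem_of_mem_erase h), ?_⟩
      rw [← erase_insert_of_ne hij]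
      exact hM.erase_mem j hj' _ hx.2
    have hJcl : ∀ x ∈ J, x.erase j ∈ J := by
      intro x hx
      rw [memJ] at hx ⊢
      exact ⟨fun h => hx.1 (mem_of_mem_erase h), hM.erase_mem j hj' _ hx.2⟩
    rcases hz with hz | ⟨hzT, hz⟩
    · exact Or.inl (hRcl _ hz)
    · by_cases hjz : j ∈ z.erase i
      swap
      · rw [erase_eq_of_notMem hjz]
        exact Or.inr ⟨hzT, hz⟩
      -- Erasing `j` either lands in `R` or follows an edge of `J \ R`, which keeps the component
      -- and its level.
      refine or_iff_not_imp_left.2 fun hzR => ?_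
      have hT : (z.erase i).erase j ∈ J \ R :=
        mem_sdiff.2 ⟨hJcl _ (mem_sdiff.1 hzT).1, hzR⟩
      refine ⟨hT, ?_⟩
      rw [← component_congr (SimpleGraph.Adj.reachable ⟨hzT, hT, ?_⟩)]
      · exact hz
      · rw [card_eq_one]
        refine ⟨j, ?_⟩
        ext x
        by_cases hx : x = j
        · subst hx; simp_all [mem_symmDiff]
        · simp [mem_symmDiff, hx]

theorem IsStage.compression {F M' : Finset (Finset (Fin n))} {i : Fin n}
    (hM : IsStage F (i + 1) M') : IsStage F i (𝓓 i M') := by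
  refine ⟨(shatterer_compress_subset_shatterer i M').trans hM.shatterer_subset,
    by rw [Down.card_compression, hM.card_eq], ?_⟩
  intro j hj z hz
  by_cases hij : i = j
  · subst hij
    exact Down.erase_mem_compression_of_mem_compression hz
  have hj' : (i : ℕ) + 1 ≤ j := by
    have : (i : ℕ) ≠ j := fun h => hij (Fin.ext h)
    omega
  have hcl := hM.erase_mem j hj'
  rw [Down.mem_compression] at hz ⊢
  rw [erase_right_comm, ← erase_insert_of_ne hij]
  rcases hz with ⟨h1, h2⟩ | ⟨h1, h2⟩
  · exact Or.inl ⟨hcl _ h1, hcl _ h2⟩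
  · have hiz : i ∉ z := fun h => h1 (by rwa [insert_eq_of_mem h] at h2)
    by_cases h : z.erase j ∈ M'
    · exact Or.inl ⟨h, by rwa [erase_eq_of_notMem hiz]⟩
    · exact Or.inr ⟨h, hcl _ h2⟩

theorem symmDiff_singleton_of_notMem {i : Fin n} {y : Finset (Fin n)} (hi : i ∉ y) :
    symmDiff y {i} = insert i y := by
  ext w
  simp only [mem_symmDiff, mem_insert, mem_singleton]
  by_cases hw : w = i
  · subst hw; tauto
  · tauto

theorem symmDiff_insert_eq_pair {i j : Fin n} {x y : Finset (Fin n)} (hx : i ∉ x) (hy : i ∉ y)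
    (h : symmDiff x y = {j}) : symmDiff y (insert i x) = {i, j} := by
  ext w
  have := Finset.ext_iff.1 h w
  simp only [mem_symmDiff, mem_insert, mem_singleton] at this ⊢
  by_cases hw : w = i
  · subst hw; tauto
  · tauto

/-- The level must be constant on components. If adjacent `x`, `y` outside `R` sat at levels `1` and
`0`, isometry between `y` and `insert i x` would put `insert i y` or `x` into `M'`, a contradiction
either way. -/
theorem IsAmple.exists_isLift_compression {M' : Finset (Finset (Fin n))} (hM : IsAmple M')
    (i : Fin n) : ∃ g, IsLift i (𝓓 i M') M' g := by
  classical
  set R := reduction i (𝓓 i M') with hR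
  set J := projAlong i (𝓓 i M') with hJ
  have memR : ∀ x, x ∈ R ↔ i ∉ x ∧ x ∈ M' ∧ insert i x ∈ M' := fun x => by
    rw [hR, mem_reduction, Down.mem_compression, Down.mem_compression]
    refine and_congr_right fun hx => ?_
    simp only [erase_eq_of_notMem hx, erase_insert hx, insert_idem]
    tauto
  have memJ : ∀ x, x ∈ J ↔ i ∉ x ∧ (x ∈ M' ∨ insert i x ∈ M') := fun x => by
    rw [hJ, mem_projAlong, Down.mem_compression, Down.mem_compression]
    refine and_congr_right fun hx => ?_
    simp only [erase_eq_of_notMem hx, erase_insert hx, insert_idem]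
    tauto
  have hadj : ∀ x y, (cubeGraphOn (J \ R)).Adj x y → insert i x ∈ M' → insert i y ∈ M' := by
    rintro x y ⟨hx, hy, hxy⟩ hxM
    by_contra hyM
    rw [mem_sdiff, memJ, memR] at hx hy
    have hix := hx.1.1
    have hiy := hy.1.1
    have hyM' : y ∈ M' := by tauto
    obtain ⟨j, hj⟩ := card_eq_one.1 hxy
    have hyx : y = symmDiff x {j} := by rw [← hj, symmDiff_symmDiff_cancel_left]
    have hsd : symmDiff y (insert i x) = {i, j} := symmDiff_insert_eq_pair hix hiy hj
    obtain ⟨k, hk, hkM⟩ := hM.exists_step hyM' hxM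
      (fun h => hiy (h ▸ mem_insert_self i x))
    rw [hsd, mem_insert, mem_singleton] at hk
    rcases hk with rfl | rfl
    · apply hyM
      rwa [symmDiff_singleton_of_notMem hiy] at hkM
    · have hx' : symmDiff y {k} = x := by
        rw [hyx]; exact symmDiff_symmDiff_cancel_right _ _
      rw [hx'] at hkM
      exact hx.2 ⟨hix, hkM, hxM⟩
  have hreach : ∀ x y, (cubeGraphOn (J \ R)).Reachable x y → insert i x ∈ M' →
      insert i y ∈ M' := by
    rintro x y ⟨w⟩
    induction w with
    | nil => exact id
    | cons h _ ih => exact fun hx => ih (hadj _ _ h hx)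
  refine ⟨fun K => decide (∃ x ∈ K, insert i x ∈ M'), fun z => ?_⟩
  have hgz : z.erase i ∈ J \ R → ((∃ x ∈ component (J \ R) (z.erase i), insert i x ∈ M') ↔
      insert i (z.erase i) ∈ M') := by
    intro hz
    constructor
    · rintro ⟨x, hx, hxM⟩
      exact hreach _ _ (mem_component.1 hx).2.symm hxM
    · exact fun h => ⟨_, mem_component.2 ⟨hz, SimpleGraph.Reachable.refl _⟩, h⟩
  simp only [decide_eq_true_eq]
  rw [and_congr_right fun h => iff_congr Iff.rfl (hgz h), mem_sdiff, memJ, memR]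
  by_cases hz : i ∈ z
  · simp [hz, insert_erase hz]
    tauto
  · simp [hz]
    tauto

end Lift

/-! ### The queue during the run. -/

section Run

variable {n : ℕ}

/-- The queue of the algorithm after the first `m` coordinates. -/
noncomputable def queueAfter (F Cbar : Finset (Finset (Fin n))) (m : ℕ) :
    Finset (Finset (Finset (Fin n))) :=
  ((List.finRange n).take m).foldl
    (fun queue i => queue.biUnion (processClass (prefixProj i Cbar) i)) {F}

theorem queueAfter_succ (F Cbar : Finset (Finset (Fin n))) (i : Fin n) :
    queueAfter F Cbar (i + 1) =
      (queueAfter F Cbar i).biUnion (processClass (prefixProj i Cbar) i) := by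
  have h : (i : ℕ) < (List.finRange n).length := by simp
  rw [queueAfter, List.take_succ_eq_append_getElem h, List.foldl_append]
  simp [queueAfter]

/-- Closure in all coordinates makes `M` a lower set, which equals its own shatterer. -/
theorem isStage_zero_iff {F M : Finset (Finset (Fin n))}
    (hF : IsLowerSet (F : Set (Finset (Fin n)))) : IsStage F 0 M ↔ M = F := by
  constructor
  · intro h
    have hlow : ∀ (s x : Finset (Fin n)), x ∈ M → x \ s ∈ M := by
      intro s
      induction s using Finset.induction_on with
      | empty => simp
      | insert a s _ ih =>
        intro x hx
        rw [sdiff_insert]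
        exact h.erase_mem a (Nat.zero_le _) _ (ih x hx)
    have hM : IsLowerSet (M : Set (Finset (Fin n))) := by
      intro x y hyx hx
      have := hlow (x \ y) x hx
      rwa [Finset.sdiff_sdiff_eq_self hyx] at this
    rw [← shatterer_eq] at hM
    exact eq_of_subset_of_card_le (hM ▸ h.shatterer_subset) h.card_eq.ge
  · rintro rfl
    exact ⟨(shatterer_eq.2 hF).le, rfl, fun j _ x hx => hF (erase_subset j x) hx⟩

theorem prefixProj_compression_subset {i j : Fin n} (hij : j < i)
    (M : Finset (Finset (Fin n))) : prefixProj j (𝓓 i M) ⊆ prefixProj j M := by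
  intro y hy
  obtain ⟨z, hz, rfl⟩ := mem_image.1 hy
  rw [Down.mem_compression] at hz
  rcases hz with hz | hz
  · exact mem_image_of_mem _ hz.1
  · refine mem_image.2 ⟨_, hz.2, ?_⟩
    rw [insert_inter_of_notMem]
    simpa using hij

theorem prefixProj_subset_of_le {i j : Fin n} (hij : j ≤ i) {M N : Finset (Finset (Fin n))}
    (h : prefixProj i M ⊆ prefixProj i N) : prefixProj j M ⊆ prefixProj j N := by
  intro y hy
  obtain ⟨z, hz, rfl⟩ := mem_image.1 hy
  obtain ⟨w, hw, hwz⟩ := mem_image.1 (h (mem_image_of_mem _ hz))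
  refine mem_image.2 ⟨w, hw, ?_⟩
  ext x
  have := Finset.ext_iff.1 hwz x
  simp only [mem_inter, mem_Iic] at *
  constructor <;> rintro ⟨h1, h2⟩ <;> have := h2.trans hij <;> tauto

/-- Only the most recent test is recorded, since it implies the earlier ones for the successive
compressions. Writing it with `j + 1 = m` makes it vacuous at `m = 0`. -/
theorem mem_queueAfter_iff {F : Finset (Finset (Fin n))}
    (hF : IsLowerSet (F : Set (Finset (Fin n)))) (Cbar : Finset (Finset (Fin n))) (m : ℕ)
    (hm : m ≤ n) (M : Finset (Finset (Fin n))) :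
    M ∈ queueAfter F Cbar m ↔ IsStage F m M ∧
      ∀ j : Fin n, (j : ℕ) + 1 = m → prefixProj j M ⊆ prefixProj j Cbar := by
  induction m generalizing M with
  | zero => simp [queueAfter, isStage_zero_iff hF]
  | succ m ih =>
    have hcast : m = ((⟨m, hm⟩ : Fin n) : ℕ) := rfl
    generalize (⟨m, hm⟩ : Fin n) = i at hcast
    subst hcast
    rw [queueAfter_succ, mem_biUnion]
    constructor
    · rintro ⟨N, hN, hM⟩
      rw [ih (by omega)] at hN
      obtain ⟨hP, g, hg⟩ := mem_processClass.1 hM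
      refine ⟨hN.1.lift hg, fun j hj => ?_⟩
      obtain rfl : j = i := Fin.ext (by omega)
      exact hP
    -- The predecessor in the queue is the compression of `M`.
    · rintro ⟨hM, hP⟩
      refine ⟨𝓓 i M, (ih (by omega) _).2 ⟨hM.compression, fun j hj => ?_⟩,
        mem_processClass.2 ⟨hP i rfl, hM.isAmple.exists_isLift_compression i⟩⟩
      have hji : j < i := Fin.lt_def.2 (by omega)
      exact (prefixProj_compression_subset hji M).trans
        (prefixProj_subset_of_le hji.le (hP i rfl))

/-- The last prefix is the whole cube. With `n = 0` no test would be made, hence `0 < n`. -/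
theorem mem_queueAfter_self_iff {F : Finset (Finset (Fin n))}
    (hF : IsLowerSet (F : Set (Finset (Fin n)))) (hn : 0 < n) (Cbar : Finset (Finset (Fin n)))
    (M : Finset (Finset (Fin n))) :
    M ∈ queueAfter F Cbar n ↔ (M.shatterer ⊆ F ∧ M.card = F.card) ∧ M ⊆ Cbar := by
  rw [mem_queueAfter_iff hF Cbar n le_rfl]
  have hproj : ∀ j : Fin n, (j : ℕ) + 1 = n → ∀ N : Finset (Finset (Fin n)),
      prefixProj j N = N := by
    intro j hj N
    have hI : (Iic j : Finset (Fin n)) = univ := by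
      ext x
      simp only [mem_Iic, mem_univ, iff_true, Fin.le_def]
      omega
    simp [prefixProj, hI]
  refine and_congr ⟨fun h => ⟨h.1, h.2⟩, fun h => ⟨h.1, h.2, fun j hj => ?_⟩⟩
    ⟨fun h => ?_, fun h j hj => ?_⟩
  · exact absurd j.2 (by omega)
  · have := h ⟨n - 1, by omega⟩ (Nat.sub_add_cancel hn)
    rwa [hproj _ (Nat.sub_add_cancel hn), hproj _ (Nat.sub_add_cancel hn)] at this
  · rwa [hproj j hj, hproj j hj]

end Run

/-! ### Maximum classes and their complements. -/

section Maximum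

variable {n : ℕ}

theorem card_filter_card_le (n e : ℕ) :
    (univ.filter fun x : Finset (Fin n) => x.card ≤ e).card =
      ∑ i ∈ range (e + 1), n.choose i := by
  rw [card_eq_sum_card_fiberwise (f := card) (t := range (e + 1))]
  · refine sum_congr rfl fun i hi => ?_
    rw [filter_filter]
    rw [mem_range] at hi
    have : (univ.filter fun x : Finset (Fin n) => x.card ≤ e ∧ x.card = i) =
        powersetCard i univ := by
      ext x
      simp only [mem_filter, mem_univ, true_and, mem_powersetCard, subset_univ]
      omega
    rw [this, card_powersetCard, card_univ, Fintype.card_fin]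
  · intro x hx
    simp at hx ⊢
    omega

/-- With Sauer's cardinality, Pajor's bound forces the shatterer to be all sets of size at most `e`;
`e ≤ n` supplies one of size exactly `e`. -/
theorem isMaximum_iff {D : Finset (Finset (Fin n))} {e : ℕ} (he : e ≤ n) :
    IsMaximum D e ↔ D.shatterer ⊆ (univ.filter fun x => x.card ≤ e) ∧
      D.card = (univ.filter fun x : Finset (Fin n) => x.card ≤ e).card := by
  rw [IsMaximum, card_filter_card_le]
  refine and_congr_left fun hcard => ⟨fun h A hA => ?_, fun h => le_antisymm ?_ ?_⟩
  · rw [mem_filter]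
    exact ⟨mem_univ _, h ▸ (mem_shatterer.1 hA).card_le_vcDim⟩
  · exact Finset.sup_le fun A hA => (mem_filter.1 (h hA)).2
  · rw [← card_filter_card_le] at hcard
    have heq := eq_of_subset_of_card_le h (hcard ▸ card_le_card_shatterer D)
    obtain ⟨A, -, hA⟩ := exists_subset_card_eq (s := (univ : Finset (Fin n))) (n := e)
      (by simpa using he)
    have : A ∈ D.shatterer := by
      rw [heq, mem_filter]
      exact ⟨mem_univ _, hA.le⟩
    exact hA ▸ (mem_shatterer.1 this).card_le_vcDim

/-- Complementation exchanges the classes that are extremal for a lower set `G` and those that are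
extremal for the dual lower set `F`. -/
theorem shatterer_compl_subset {D F G : Finset (Finset (Fin n))}
    (hFG : ∀ A, A ∈ F ↔ Aᶜ ∉ G) (hsh : D.shatterer ⊆ G) (hcard : D.card = G.card) :
    Dᶜ.shatterer ⊆ F ∧ Dᶜ.card = F.card := by
  have hD : IsAmple D := (card_le_card hsh).trans hcard.ge
  have heq := eq_of_subset_of_card_le hsh (hcard ▸ card_le_card_shatterer D)
  refine ⟨fun A hA => ?_, ?_⟩
  · rw [hFG, ← heq, mem_shatterer]
    exact hD.shatters_compl_iff.1 (mem_shatterer.1 hA)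
  · have hF : F = Gᶜ.image compl := by
      ext A
      rw [hFG, mem_image]
      constructor
      · exact fun h => ⟨Aᶜ, mem_compl.2 h, compl_compl A⟩
      · rintro ⟨B, hB, rfl⟩
        rwa [compl_compl, ← mem_compl]
    rw [hF, card_image_of_injective _ compl_injective, card_compl, card_compl, hcard]

theorem isMaximum_iff_compl {D : Finset (Finset (Fin n))} {e : ℕ} (he : e ≤ n) :
    IsMaximum D e ↔ Dᶜ.shatterer ⊆ (univ.filter fun x => x.card + e + 1 ≤ n) ∧
      Dᶜ.card = (univ.filter fun x : Finset (Fin n) => x.card + e + 1 ≤ n).card := by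
  have hcompl : ∀ A : Finset (Fin n), Aᶜ.card + A.card = n := fun A => by
    simp [card_compl_add_card A]
  rw [isMaximum_iff he]
  constructor
  · rintro ⟨h1, h2⟩
    refine shatterer_compl_subset (fun A => ?_) h1 h2
    have := hcompl A
    simp only [mem_filter, mem_univ, true_and]
    omega
  · rintro ⟨h1, h2⟩
    rw [← compl_compl D]
    refine shatterer_compl_subset (fun A => ?_) h1 h2
    have := hcompl A
    simp only [mem_filter, mem_univ, true_and]
    omega

theorem not_isMaximum_of_lt {D : Finset (Finset (Fin n))} {e : ℕ} (he : n < e) :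
    ¬ IsMaximum D e := by
  rintro ⟨h, -⟩
  have : D.vcDim ≤ n := Finset.sup_le fun A _ => by simpa using card_le_univ A
  omega

end Maximum

end VCEmbed

open VCEmbed in
theorem mainTheorem7 (n d k : ℕ) (C : Finset (Finset (Fin n))) (hC : C.vcDim = d) (hk : 0 < k) :
    {D : Finset (Finset (Fin n)) | Dᶜ ∈ VCEmbed.allEmbeddings n d k Cᶜ} =
      {D : Finset (Finset (Fin n)) | VCEmbed.IsMaximum D (d + k) ∧ C ⊆ D} := by
  ext D
  rw [Set.mem_ofPred_eq, Set.mem_ofPred_eq]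
  by_cases hn : d + k ≤ n
  · set F : Finset (Finset (Fin n)) := univ.filter fun x => x.card + (d + k) + 1 ≤ n with hF
    have hlow : IsLowerSet (F : Set (Finset (Fin n))) := by
      intro x y hyx hx
      have := card_le_card hyx
      simp only [hF, coe_filter, mem_univ, true_and, Set.mem_ofPred_eq] at hx ⊢
      omega
    have hq : allEmbeddings n d k Cᶜ = queueAfter F Cᶜ n := by
      simp only [allEmbeddings, queueAfter, initialQueue, if_pos hn, hF, add_assoc]
      rw [List.take_of_length_le (by simp)]
    -- Here `0 < n` comes from `0 < k` and `d + k ≤ n`.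
    rw [hq, mem_queueAfter_self_iff hlow (by omega), isMaximum_iff_compl hn,
      compl_subset_compl]
  · refine iff_of_false ?_ fun h => not_isMaximum_of_lt (not_le.1 hn) h.1
    have hempty : ∀ l : List (Fin n), l.foldl
        (fun (queue : Finset (Finset (Finset (Fin n)))) i => queue.biUnion (processClass (prefixProj i Cᶜ) i)) ∅ = ∅ := by
      intro l
      induction l with
      | nil => rfl
      | cons a l ih => simpa using ih
    simp [allEmbeddings, initialQueue, hn, hempty]
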